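/- Write $[\mathbb N]^\infty$ for the Polish space of infinite subsets of $\mathbb N$ (a subspace of $2^{\mathbb N}$). For a finite $s\subseteq\mathbb N$ and $A\in[\mathbb N]^\infty$ with $\max s<\min A$ (any $A$ if $s=\emptyset$) let $[s,A]^\infty=\{x\in[\mathbb N]^\infty : s\subseteq x\subseteq s\cup A\}$ be the corresponding Ellentuck-basic open set; thus $[\emptyset,A]^\infty=[A]^\infty$. A set $P\subseteq[\mathbb N]^\infty$ is completely Ramsey if for all such $s,A$ there is an infinite $B\subseteq A$ with $[s,B]^\infty\subseteq P$ or $[s,B]^\infty\cap P=\emptyset$. A pointclass is a class of subsets of Polish spaces that contains all Borel subsets of every Polish space and is closed under (finite) intersections and continuous preimages. A function $f$ with domain $D\subseteq[\mathbb N]^\infty$ is $\Gamma'$-measurable if $f^{-1}(U)\in\Gamma'$ (as a subset of $[\mathbb N]^\infty$) for every open $U$. For every ordinal $0<\alpha<\omega_1$ fix a non-decreasing sequence $\langle\gamma^\alpha_n:n\in\mathbb N\rangle$ of ordinals with $\bigcup_n(\gamma^\alpha_n+1)=\alpha$. Let $S_0=\{\emptyset\}$, $\mathrm{Fin}^0=\{\emptyset\}$,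 and for $0<\alpha<\omega_1$ let $S_\alpha=\{n^\frown s: n\in\mathbb N,\ s\in S_{\gamma^\alpha_n}\}$, a countable set of finite sequences of natural numbers, and let $\mathrm{Fin}^\alpha$ be the ideal of all $X\subseteq S_\alpha$ such that $\{s: n^\frown s\in X\}\in\mathrm{Fin}^{\gamma^\alpha_n}$ for all but finitely many $n$ (so $\mathrm{Fin}^1$ is the ideal of finite subsets of $S_1\cong\mathbb N$). A $\mathrm{Fin}^\alpha$-almost disjoint family is a set $\mathcal A\subseteq\mathcal P(S_\alpha)\setminus\mathrm{Fin}^\alpha$ such that $X\cap Y\in\mathrm{Fin}^\alpha$ for all distinct $X,Y\in\mathcal A$; it is $\mathrm{Fin}^\alpha$-mad if it is not a proper subset of another $\mathrm{Fin}^\alpha$-almost disjoint family. The space $\mathcal P(S_\alpha)$ is identified with the Polish space $2^{S_\alpha}$. **Theorem.** Let $\Gamma$ and $\Gamma'$ be pointclasses such that every subset of $[\mathbb N]^\infty$ in $\Gamma'$ is completely Ramsey. Suppose that for every relation $R\subseteq[\mathbb N]^\infty\times[\mathbb N]^\infty$ in $\Gamma$ such that for each $x\in[\mathbb N]^\infty$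 there is $y$ with $(x,y)\in R$, there are an Ellentuck-basic open set $[s,A]^\infty$ and a $\Gamma'$-measurable function $f:[s,A]^\infty\to[\mathbb N]^\infty$ with $(x,f(x))\in R$ for all $x\in[s,A]^\infty$. Then, for every ordinal $0<\alpha<\omega_1$, there is no $\mathrm{Fin}^\alpha$-mad family in $\Gamma$ that is Dedekind infinite, i.e. into which $\mathbb N$ injects. -/

import Mathlib

open scoped Ordinal

namespace FinAlpha

/-! ### Pointclasses -/

/-- A pointclass: a class of subsets of Polish spaces that contains the Borel sets of every Polish
space and is closed under (finite) intersections and continuous preimages. -/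
structure Pointclass where
  /-- `mem X B` says that the subset `B` of the Polish space `X` belongs to the class. -/
  mem : ∀ (X : Type) [TopologicalSpace X] [PolishSpace X], Set X → Prop
  borel_mem : ∀ (X : Type) [TopologicalSpace X] [PolishSpace X] (B : Set X),
    @MeasurableSet X (borel X) B → mem X B
  inter_mem : ∀ (X : Type) [TopologicalSpace X] [PolishSpace X] (B C : Set X),
    mem X B → mem X C → mem X (B ∩ C)
  preimage_mem : ∀ (X Y : Type) [TopologicalSpace X] [PolishSpace X] [TopologicalSpace Y]
    [PolishSpace Y] (f : X → Y) (B : Set Y), Continuous f → mem Y B → mem X (f ⁻¹' B)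

/-! ### The space of infinite sets of natural numbers -/

/-- The space `[ℕ]^∞` of infinite subsets of `ℕ`, given by their characteristic functions, with
the topology inherited from the Cantor space. -/
abbrev InfSet : Type := {x : ℕ → Bool // {n | x n = true}.Infinite}

/-- The infinite set of natural numbers that a point of `[ℕ]^∞` is. -/
def InfSet.toSet (x : InfSet) : Set ℕ := {n | x.1 n = true}

theorem InfSet.exists_next (x : InfSet) (n : ℕ) : ∃ m, n ≤ m ∧ x.1 m = true := by
  obtain ⟨m, hm, hnm⟩ := x.2.exists_gt n
  exact ⟨m, hnm.le, hm⟩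

/-- `[ℕ]^∞` is a Polish space. -/
instance InfSet.instPolishSpace : PolishSpace InfSet := by
  classical
  let g : InfSet → ℕ → ℕ := fun x n => Nat.find (x.exists_next n)
  have hg : ∀ (x : InfSet) n, n ≤ g x n ∧ x.1 (g x n) = true :=
    fun x n => Nat.find_spec (x.exists_next n)
  have hg' : ∀ (x : InfSet) n m, n ≤ m → m < g x n → x.1 m = false := fun x n m h1 h2 => by
    have := Nat.find_min (x.exists_next n) h2
    simpa [h1] using this
  have huniq : ∀ (x : InfSet) n k, n ≤ k → x.1 k = true →
      (∀ m, n ≤ m → m < k → x.1 m = false) → g x n = k := fun x n k h1 h2 h3 => by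
    refine (Nat.find_eq_iff _).2 ⟨⟨h1, h2⟩, fun m hm hc => ?_⟩
    have := h3 m hc.1 hm
    simp [hc.2] at this
  have hcoord : ∀ m, Continuous fun x : InfSet => x.1 m := fun m =>
    (continuous_apply m).comp continuous_subtype_val
  have hgc : Continuous g := by
    refine continuous_pi fun n => continuous_discrete_rng.2 fun k => ?_
    have : (fun x => g x n) ⁻¹' {k} = {x : InfSet | n ≤ k ∧ x.1 k = true} ∩
        ⋂ m ∈ Finset.range k, {x : InfSet | n ≤ m → x.1 m = false} := by
      ext x
      simp only [Set.mem_preimage, Set.mem_singleton_iff, Set.mem_inter_iff, Set.mem_ofPred_eq,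
        Set.mem_iInter, Finset.mem_range]
      constructor
      · rintro rfl
        exact ⟨hg x n, fun m hm hn => hg' x n m hn hm⟩
      · rintro ⟨⟨h1, h2⟩, h3⟩
        exact huniq x n k h1 h2 fun m hn hm => h3 m hm hn
    rw [this]
    refine IsOpen.inter ?_ (isOpen_biInter_finset fun m _ => ?_)
    · by_cases h : n ≤ k
      · simp only [h, true_and]
        exact (isOpen_discrete ({true} : Set Bool)).preimage (hcoord k)
      · simp [h]
    · by_cases h : n ≤ m
      · simp only [h, true_imp_iff]
        exact (isOpen_discrete ({false} : Set Bool)).preimage (hcoord m)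
      · simp [h]
  let e : InfSet → (ℕ → Bool) × (ℕ → ℕ) := fun x => (x.1, g x)
  have hec : Continuous e := continuous_subtype_val.prodMk hgc
  have hemb : Topology.IsEmbedding e :=
    Topology.IsEmbedding.of_comp hec continuous_fst Topology.IsEmbedding.subtypeVal
  have hrange : Set.range e = ⋂ n, {p : (ℕ → Bool) × (ℕ → ℕ) | n ≤ p.2 n} ∩
      {p | p.1 (p.2 n) = true} ∩ ⋂ m, {p | n ≤ m → m < p.2 n → p.1 m = false} := by
    ext p
    simp only [Set.mem_range, Set.mem_iInter, Set.mem_inter_iff, Set.mem_ofPred_eq]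
    constructor
    · rintro ⟨x, rfl⟩ n
      exact ⟨hg x n, fun m h1 h2 => hg' x n m h1 h2⟩
    · intro h
      have hinf : {n | p.1 n = true}.Infinite := Set.infinite_of_not_bddAbove (by
        rintro ⟨b, hb⟩
        have := hb (h (b + 1)).1.2
        have := (h (b + 1)).1.1
        omega)
      refine ⟨⟨p.1, hinf⟩, Prod.ext rfl (funext fun n => ?_)⟩
      exact huniq ⟨p.1, hinf⟩ n (p.2 n) (h n).1.1 (h n).1.2 (h n).2
  have h2 : ∀ n, Continuous fun p : (ℕ → Bool) × (ℕ → ℕ) => p.2 n := fun n =>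
    (continuous_apply n).comp continuous_snd
  have h1 : ∀ n, Continuous fun p : (ℕ → Bool) × (ℕ → ℕ) => p.1 n := fun n =>
    (continuous_apply n).comp continuous_fst
  have heval : ∀ n, Continuous fun p : (ℕ → Bool) × (ℕ → ℕ) => p.1 (p.2 n) := fun n => by
    have hc : Continuous fun q : (ℕ → Bool) × ℕ => q.1 q.2 :=
      continuous_prod_of_discrete_right.2 fun k => continuous_apply k
    exact hc.comp (continuous_fst.prodMk (h2 n))
  have hclosed : IsClosed (Set.range e) := by
    rw [hrange]
    refine isClosed_iInter fun n => IsClosed.inter (IsClosed.inter ?_ ?_)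
      (isClosed_iInter fun m => ?_)
    · exact isClosed_le continuous_const (h2 n)
    · exact isClosed_eq (heval n) continuous_const
    · have : {p : (ℕ → Bool) × (ℕ → ℕ) | n ≤ m → m < p.2 n → p.1 m = false} =
          (fun p : (ℕ → Bool) × (ℕ → ℕ) => (p.2 n, p.1 m)) ⁻¹'
            {q | n ≤ m → m < q.1 → q.2 = false} := rfl
      rw [this]
      exact (isClosed_discrete _).preimage ((h2 n).prodMk (h1 m))
  have : PolishSpace ((ℕ → Bool) × (ℕ → ℕ)) :=
    { toSecondCountableTopology := inferInstance
      toIsCompletelyMetrizableSpace := inferInstance }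
  exact Topology.IsClosedEmbedding.polishSpace ⟨hemb, hclosed⟩

/-- The finite set `s` lies strictly below the infinite set `A`. -/
def Below (s : Finset ℕ) (A : InfSet) : Prop := ∀ i ∈ s, ∀ j ∈ A.toSet, i < j

/-- For `s` below `A`, the Ellentuck-basic open set `[s, A]^∞` of all infinite `x` with
`s ⊆ x ⊆ s ∪ A`; for `s = ∅` this is `[A]^∞`. -/
def ellentuck (s : Finset ℕ) (A : InfSet) : Set InfSet :=
  {x | (s : Set ℕ) ⊆ x.toSet ∧ x.toSet ⊆ (s : Set ℕ) ∪ A.toSet}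

/-- `P ⊆ [ℕ]^∞` is completely Ramsey. -/
def CompletelyRamsey (P : Set InfSet) : Prop :=
  ∀ (s : Finset ℕ) (A : InfSet), Below s A →
    ∃ B : InfSet, B.toSet ⊆ A.toSet ∧ (ellentuck s B ⊆ P ∨ ellentuck s B ⊆ Pᶜ)

/-- `f` uniformises the binary relation `R` on `D`. -/
def Uniformises (R : Set (InfSet × InfSet)) (D : Set InfSet) (f : D → InfSet) : Prop :=
  ∀ x : D, ((x : InfSet), f x) ∈ R

/-- The function `f` with domain `D ⊆ [ℕ]^∞` is measurable with respect to the pointclass: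
preimages of open sets belong to the pointclass. -/
def Pointclass.MeasurableFun (Γ : Pointclass) (D : Set InfSet) (f : D → InfSet) : Prop :=
  ∀ U : Set InfSet, IsOpen U → Γ.mem InfSet (Subtype.val '' (f ⁻¹' U))

/-! ### Almost disjoint families -/

/-- `𝒜` is an `I`-almost disjoint family of subsets of `S`. -/
def IsAlmostDisjoint {S : Type} (I : Set (Set S)) (𝒜 : Set (Set S)) : Prop :=
  (∀ X ∈ 𝒜, X ∉ I) ∧ ∀ X ∈ 𝒜, ∀ Y ∈ 𝒜, X ≠ Y → X ∩ Y ∈ I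

/-- `𝒜` is an `I`-mad family: an `I`-almost disjoint family that is not a proper subset of
another one. -/
def IsMad {S : Type} (I : Set (Set S)) (𝒜 : Set (Set S)) : Prop :=
  Maximal (IsAlmostDisjoint I) 𝒜

/-- For countable `S` the space `2^S` is a Polish space. -/
instance instPolishSpacePow {S : Type} [Countable S] : PolishSpace (S → Bool) :=
  { toSecondCountableTopology := inferInstance
    toIsCompletelyMetrizableSpace := inferInstance }

/-- A family of subsets of a countable set `S` belongs to the pointclass, the power set of `S`
being identified with the Polish space `2^S`. -/
def Pointclass.HasFamily (Γ : Pointclass) {S : Type} [Countable S] (𝒜 : Set (Set S)) : Prop :=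
  Γ.mem (S → Bool) {χ | {i | χ i = true} ∈ 𝒜}

/-- `𝒜` is Dedekind infinite: there is an injection from `ℕ` into `𝒜`. -/
def DedekindInfinite {T : Type} (𝒜 : Set T) : Prop := ∃ g : ℕ → 𝒜, Function.Injective g

/-! ### The ideals `Fin^α` -/

/-- The choice, for every `0 < α < ω₁`, of a non-decreasing sequence `⟨γ α n : n ∈ ℕ⟩` of
ordinals with `⋃ₙ (γ α n + 1) = α`. -/
structure IsLadderSystem (γ : Ordinal.{0} → ℕ → Ordinal.{0}) : Prop where
  mono : ∀ α, 0 < α → α < ω₁ → Monotone (γ α)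
  iUnion_eq : ∀ α, 0 < α → α < ω₁ → ⋃ n, Set.Iio (γ α n + 1) = Set.Iio α

/-- `IndexSet γ α` is the set `S_α` of finite sequences: `S_0 = {∅}` and, for `α > 0`, `S_α`
consists of the sequences `n ⌢ s` with `s ∈ S_{γ α n}`. -/
inductive IndexSet (γ : Ordinal.{0} → ℕ → Ordinal.{0}) : Ordinal.{0} → List ℕ → Prop
  | nil : IndexSet γ 0 []
  | cons {α : Ordinal.{0}} {n : ℕ} {s : List ℕ} (hα : 0 < α) (hs : IndexSet γ (γ α n) s) :
      IndexSet γ α (n :: s)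

/-- `S_α` as a (countable) type. -/
abbrev Idx (γ : Ordinal.{0} → ℕ → Ordinal.{0}) (α : Ordinal.{0}) : Type :=
  {s : List ℕ // IndexSet γ α s}

/-- `SmallSet γ α X` says that the set `X ⊆ S_α` of sequences is in `Fin^α`. By recursion on `α`:
`Fin^0 = {∅}`, and, for `α > 0`, `X ∈ Fin^α` if and only if for all but finitely many `n` the
section `X(⟨n⟩) = {s | n ⌢ s ∈ X}` is in `Fin^{γ α n}`. In particular `Fin^1` is the ideal of the
finite sets of sequences of length one. -/
inductive SmallSet (γ : Ordinal.{0} → ℕ → Ordinal.{0}) : Ordinal.{0} → Set (List ℕ) → Prop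
  | empty : SmallSet γ 0 ∅
  | step {α : Ordinal.{0}} {X : Set (List ℕ)} (hα : 0 < α) (F : Finset ℕ)
      (h : ∀ n ∉ F, SmallSet γ (γ α n) {s | n :: s ∈ X}) : SmallSet γ α X

/-- The ideal `Fin^α` on `S_α`. -/
def finIdeal (γ : Ordinal.{0} → ℕ → Ordinal.{0}) (α : Ordinal.{0}) : Set (Set (Idx γ α)) :=
  {X | SmallSet γ α (Subtype.val '' X)}

end FinAlpha

/-!
# No `Fin^α`-mad families

Suppose that `𝒜` is `Fin^α`-mad and that `A 0, A 1, …` are distinct members of it. The argument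
attaches to every infinite set `x` of natural numbers a positive set of sequences, its *tree*, in
such a way that trees can be thinned out inside an Ellentuck-basic open set.

**Reduction.** Up to relabelling, `S_α` with its ideal is replaced by a well-founded tree shape in
which every label is used, and whose successor `Nat.pair n i` of the root belongs to a positive
column of `A n` (`exists_reindex_seq`). By almost disjointness each member of the family is small in
the columns `pair n i` for almost all `i`, for all `n` but at most one.

**Trees.** Consecutive elements of `x` are read as pairs, that is, as labels, and the `k`-th label
is attached below a node that was created earlier, each node being used infinitely often (`tree`).
Such a tree is always positive. Since any label can be placed below any node, a tree can be grown,
from any given stem, inside any prescribed positive sets, one for each successor of the root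
(`exists_steered_tree`); successors with labels in the stem are finitely many, hence negligible.

**Ramsey.** By maximality every tree meets a member of `𝒜` in a positive set. Uniformise this
relation by `F` on some `[s, A]^∞`. By fusion (`exists_locally_determined`) `F` is continuous on
some `[s, B]^∞`, so the set `Q` of those `x ∈ [s, B]^∞` whose tree is contained in `F x` up to a
small set is Borel, and some `[s, C]^∞` is contained in `Q` or disjoint from it. It is not
disjoint: the tree of any `x` can be thinned out to a tree inside `F x` (`exists_tree_subset`),
and `F` has the same value there because of almost disjointness. But if `[s, C]^∞ ⊆ Q`, take any
`x` in it and grow a tree of some `z ∈ [s, C]^∞`, half of whose columns follow `F x` while the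
other half avoids it (`exists_tree_split`); the latter is possible because the labels `pair a b`
with `a, b ∈ C` run through columns of infinitely many `A a`. The tree of `z` is almost contained in `F z` and
meets `F x` in a positive set, so `F z = F x`, which does not almost contain it: a contradiction.
-/

namespace FinAlpha

open Filter

/-! ### Well-founded tree shapes and their Fréchet ideals -/

/-- The shape of a well-founded tree in which every inner node has a successor for every natural
number. The shape of `S_α` records the ranks `γ α n` met along its sequences. -/
inductive Shape : Type
  | leaf : Shape
  | node (f : ℕ → Shape) : Shape

/-- The section `X(⟨n⟩)` of a set of sequences. -/
def sec (X : Set (List ℕ)) (n : ℕ) : Set (List ℕ) := {s | n :: s ∈ X}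

/-- The iterated Fréchet ideal of a shape. Only the sequences of `X` that are leaves of the shape
matter. -/
def Small : Shape → Set (List ℕ) → Prop
  | .leaf, X => [] ∉ X
  | .node f, X => ∀ᶠ n in atTop, Small (f n) (sec X n)

theorem Small.mono {sh : Shape} {X Y : Set (List ℕ)} (hY : Small sh Y) (h : X ⊆ Y) :
    Small sh X := by
  induction sh generalizing X Y with
  | leaf => exact fun hX => hY (h hX)
  | node f ih => exact Eventually.mono hY fun n hn => ih n hn fun s hs => h hs

theorem Small.union {sh : Shape} {X Y : Set (List ℕ)} (hX : Small sh X) (hY : Small sh Y) :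
    Small sh (X ∪ Y) := by
  induction sh generalizing X Y with
  | leaf => exact fun h => h.elim hX hY
  | node f ih =>
    filter_upwards [hX, hY] with n h1 h2
    exact ih n h1 h2

theorem small_empty (sh : Shape) : Small sh ∅ := by
  induction sh with
  | leaf => exact fun h => h
  | node f ih => exact Eventually.of_forall fun n => ih n

theorem measurableSet_small {Ω : Type*} [MeasurableSpace Ω] (sh : Shape)
    (W : Ω → Set (List ℕ)) (hW : ∀ l, MeasurableSet {x | l ∈ W x}) :
    MeasurableSet {x | Small sh (W x)} := by
  induction sh generalizing W with
  | leaf => exact (hW []).compl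
  | node f ih =>
    have : {x | Small (.node f) (W x)} = ⋃ a, ⋂ n, ⋂ (_ : a ≤ n),
        {x | Small (f n) (sec (W x) n)} := by
      ext x
      simp [Small, eventually_atTop]
    rw [this]
    exact .iUnion fun a => .iInter fun n => .iInter fun _ =>
      ih n (fun x => sec (W x) n) fun l => hW (n :: l)

/-- `S_α` with the ideal `Fin^α` has a shape. -/
theorem exists_shape {γ : Ordinal.{0} → ℕ → Ordinal.{0}} (hγ : IsLadderSystem γ)
    (α : Ordinal.{0}) (hα : α < ω₁) :
    ∃ sh : Shape, (0 < α → ∃ f, sh = .node f) ∧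
      ∀ X : Set (List ℕ), SmallSet γ α (X ∩ {s | IndexSet γ α s}) ↔ Small sh X := by
  induction α using WellFoundedLT.induction with
  | _ α ih =>
    rcases eq_or_ne α 0 with rfl | h0
    · refine ⟨.leaf, fun h => absurd h (lt_irrefl _), fun X => ⟨?_, fun h => ?_⟩⟩
      · intro h h'
        generalize hE : X ∩ {s | IndexSet γ 0 s} = E at h
        have hm : [] ∈ E := hE ▸ ⟨h', IndexSet.nil⟩
        cases h with
        | empty => exact hm
        | step h0 _ _ => exact lt_irrefl _ h0
      · have : X ∩ {s | IndexSet γ 0 s} = ∅ := by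
          refine Set.eq_empty_of_forall_notMem fun s hs => ?_
          obtain ⟨h1, h2⟩ := hs
          cases h2 with
          | nil => exact h h1
          | cons h0 _ => exact lt_irrefl _ h0
        rw [this]
        exact .empty
    · have hpos : 0 < α := pos_iff_ne_zero.2 h0
      have hlt : ∀ n, γ α n < α := fun n => by
        have : γ α n ∈ ⋃ n, Set.Iio (γ α n + 1) :=
          Set.mem_iUnion.2 ⟨n, by simp⟩
        rwa [hγ.iUnion_eq α hpos hα] at this
      choose f _ hf using fun n => ih (γ α n) (hlt n) ((hlt n).trans hα)
      refine ⟨.node f, fun _ => ⟨f, rfl⟩, fun X => ?_⟩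
      have hsec : ∀ n, {s | n :: s ∈ X ∩ {s | IndexSet γ α s}} =
          sec X n ∩ {s | IndexSet γ (γ α n) s} := fun n => by
        ext s
        refine and_congr_right fun _ => ⟨fun h => ?_, fun h => .cons hpos h⟩
        cases h with
        | cons _ h => exact h
      constructor
      · intro h
        generalize hE : X ∩ {s | IndexSet γ α s} = E at h
        cases h with
        | empty => exact absurd rfl h0
        | step _ F h =>
          subst hE
          rw [Small, ← Nat.cofinite_eq_atTop]
          refine (F.finite_toSet.subset fun n hn => ?_)
          by_contra hF
          exact hn ((hf n _).1 (hsec n ▸ h n hF))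
      · intro h
        rw [Small, ← Nat.cofinite_eq_atTop] at h
        refine .step hpos (Set.Finite.toFinset h) fun n hn => ?_
        rw [hsec, hf]
        by_contra hc
        exact hn ((Set.Finite.mem_toFinset _).2 hc)

/-- Relabelling: the successor `i` of the root is renamed `k i`, and the rest of the sequence is
changed by `φ i`. -/
def relabel (k : ℕ → ℕ) (φ : ℕ → List ℕ → List ℕ) : List ℕ → List ℕ
  | [] => []
  | i :: s => k i :: φ i s

theorem Small.image_relabel {f g : ℕ → Shape} {k : ℕ → ℕ} (hk : StrictMono k)
    {φ : ℕ → List ℕ → List ℕ} (hφ : ∀ i Z, Small (g i) Z → Small (f (k i)) (φ i '' Z))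
    {Z : Set (List ℕ)} (h : Small (.node g) Z) : Small (.node f) (relabel k φ '' Z) := by
  have hfin : {i | ¬ Small (g i) (sec Z i)}.Finite := by
    rw [Small, ← Nat.cofinite_eq_atTop] at h
    exact h
  rw [Small, ← Nat.cofinite_eq_atTop]
  refine (hfin.image k).subset fun n hn => ?_
  by_contra hc
  refine hn ?_
  by_cases hr : ∃ i, k i = n
  · obtain ⟨i, rfl⟩ := hr
    refine (hφ i (sec Z i) (by_contra fun hs => hc ⟨i, hs, rfl⟩)).mono ?_
    rintro s ⟨l, hl, hls⟩
    cases l with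
    | nil => simp [relabel] at hls
    | cons j t =>
      simp only [relabel, List.cons.injEq] at hls
      obtain rfl := hk.injective hls.1
      exact ⟨t, hl, hls.2⟩
  · refine (small_empty (f n)).mono ?_
    rintro s ⟨l, hl, hls⟩
    cases l with
    | nil => simp [relabel] at hls
    | cons j t =>
      simp only [relabel, List.cons.injEq] at hls
      exact hr ⟨j, hls.1⟩

/-- A positive set contains a copy of the leaves of another shape, in which every natural number
occurs as a label: the ideal of that shape is the trace of the given one. -/
theorem exists_reindex (sh : Shape) (X : Set (List ℕ)) (hX : ¬ Small sh X) :
    ∃ (sh' : Shape) (φ : List ℕ → List ℕ),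
      (∀ W, Small sh (W ∩ X) → Small sh' (φ ⁻¹' W)) ∧ ∀ Z, Small sh' Z → Small sh (φ '' Z) := by
  induction sh generalizing X with
  | leaf =>
    refine ⟨.leaf, id, fun W h h' => h ⟨h', not_not.1 hX⟩, fun Z h => ?_⟩
    rwa [Set.image_id]
  | node f ih =>
    obtain ⟨k, hk, hkX⟩ := extraction_of_frequently_atTop (not_eventually.1 hX)
    choose g φ h1 h2 using fun i => ih (k i) _ (hkX i)
    refine ⟨.node g, relabel k φ, fun W h => ?_, fun Z h => h.image_relabel hk h2⟩
    filter_upwards [hk.tendsto_atTop.eventually h] with i hi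
    exact h1 i _ hi

/-- The same for countably many positive sets at once, the successor `pair n i` of the root
belonging to the `n`-th set; distinct successors come from distinct columns. -/
theorem exists_reindex_seq (f : ℕ → Shape) (A : ℕ → Set (List ℕ))
    (hA : ∀ n, ¬ Small (.node f) (A n)) :
    ∃ (g : ℕ → Shape) (φ : List ℕ → List ℕ),
      (∀ W, Small (.node f) W → Small (.node g) (φ ⁻¹' W)) ∧
      (∀ Z, Small (.node g) Z → Small (.node f) (φ '' Z)) ∧
      ∀ W n, Small (.node f) (W ∩ A n) →
        ∀ᶠ i in atTop, Small (g (Nat.pair n i)) (sec (φ ⁻¹' W) (Nat.pair n i)) := by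
  obtain ⟨k, hk, hkA⟩ := extraction_forall_of_frequently
    fun c : ℕ => not_eventually.1 (hA c.unpair.1)
  choose g φ h1 h2 using fun c => exists_reindex (f (k c)) _ (hkA c)
  refine ⟨g, relabel k φ, fun W h => ?_, fun Z h => h.image_relabel hk h2, fun W n h => ?_⟩
  · filter_upwards [hk.tendsto_atTop.eventually h] with i hi
    exact h1 i _ (hi.mono Set.inter_subset_left)
  · have ht : Tendsto (fun i => k (Nat.pair n i)) atTop atTop :=
      tendsto_atTop_mono (fun i => (Nat.right_le_pair n i).trans (hk.id_le _)) tendsto_id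
    filter_upwards [ht.eventually h] with i hi
    refine h1 (Nat.pair n i) (sec W (k (Nat.pair n i))) ?_
    rw [Nat.unpair_pair]
    exact hi

/-! ### Trees grown from sequences of labels -/

/-- The nodes of the tree grown from the sequence `w` of labels: node `0` is the root, and node
`k + 1` is a successor, by the label `w k`, of the node `k.unpair.1 ≤ k`. Every node thus has
infinitely many successors. -/
def treeNode (w : ℕ → ℕ) : ℕ → List ℕ
  | 0 => []
  | k + 1 => treeNode w k.unpair.1 ++ [w k]
termination_by k => k
decreasing_by exact Nat.lt_succ_of_le (Nat.unpair_left_le k)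

/-- The set of all nodes of the tree grown from `w`. -/
def tree (w : ℕ → ℕ) : Set (List ℕ) := Set.range (treeNode w)

theorem treeNode_zero (w : ℕ → ℕ) : treeNode w 0 = [] := by
  rw [treeNode]

theorem treeNode_succ (w : ℕ → ℕ) (k : ℕ) :
    treeNode w (k + 1) = treeNode w k.unpair.1 ++ [w k] := by
  rw [treeNode]

theorem treeNode_congr {w w' : ℕ → ℕ} (k : ℕ) (h : ∀ i < k, w i = w' i) :
    treeNode w k = treeNode w' k := by
  induction k using Nat.strong_induction_on with
  | _ k ih =>
    cases k with
    | zero => simp [treeNode_zero]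
    | succ k =>
      have hk := Nat.unpair_left_le k
      rw [treeNode_succ, treeNode_succ, h k (Nat.lt_succ_self k),
        ih _ (Nat.lt_succ_of_le hk) fun i hi => h i (by omega)]

theorem treeNode_labels (w : ℕ → ℕ) (k : ℕ) : ∀ c ∈ treeNode w k, ∃ i < k, w i = c := by
  induction k using Nat.strong_induction_on with
  | _ k ih =>
    cases k with
    | zero => simp [treeNode_zero]
    | succ k =>
      intro c hc
      have hk := Nat.unpair_left_le k
      rw [treeNode_succ, List.mem_append, List.mem_singleton] at hc
      rcases hc with hc | rfl
      · obtain ⟨i, hi, h⟩ := ih _ (Nat.lt_succ_of_le hk) c hc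
        exact ⟨i, by omega, h⟩
      · exact ⟨k, Nat.lt_succ_self k, rfl⟩

theorem tendsto_atTop_comp_pair {w : ℕ → ℕ} (hw : ∀ k, k ≤ w k) (p : ℕ) :
    Tendsto (fun i => w (Nat.pair p i)) atTop atTop :=
  tendsto_atTop_mono (fun i => (Nat.right_le_pair p i).trans (hw _)) tendsto_id

theorem not_small_tree_above {w : ℕ → ℕ} (hw : ∀ k, k ≤ w k) (sh : Shape) (k : ℕ) :
    ¬ Small sh {s | treeNode w k ++ s ∈ tree w} := by
  induction sh generalizing k with
  | leaf => exact not_not.2 ⟨k, by simp⟩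
  | node f ih =>
    refine fun h => ?_
    obtain ⟨i, hi⟩ := ((tendsto_atTop_comp_pair hw k).eventually h).exists
    refine ih _ (Nat.pair k i + 1) (hi.mono fun s hs => ?_)
    simpa [sec, treeNode_succ] using hs

theorem not_small_tree {w : ℕ → ℕ} (hw : ∀ k, k ≤ w k) (sh : Shape) : ¬ Small sh (tree w) :=
  fun h => not_small_tree_above hw sh 0 (h.mono fun s hs => by simpa [treeNode_zero] using hs)

theorem not_small_sec_tree {w : ℕ → ℕ} (hw : ∀ k, k ≤ w k) (sh : Shape) (i : ℕ) :
    ¬ Small sh (sec (tree w) (w (Nat.pair 0 i))) :=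
  fun h => not_small_tree_above hw sh (Nat.pair 0 i + 1) (h.mono fun s hs => by
    simpa [sec, treeNode_succ, treeNode_zero] using hs)

/-! ### Steering a tree into a positive set -/

/-- The sequence `l` is a good node for `Z`: what `Z` contains above `l` is positive. Sequences
beyond a leaf are good if the leaf is in `Z`. -/
def Good : Shape → Set (List ℕ) → List ℕ → Prop
  | .leaf, Z, _ => [] ∈ Z
  | .node f, Z, [] => ¬ Small (.node f) Z
  | .node f, Z, c :: l => Good (f c) (sec Z c) l

theorem good_nil {sh : Shape} {Z : Set (List ℕ)} : Good sh Z [] ↔ ¬ Small sh Z := by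
  cases sh <;> simp [Good, Small]

/-- The finite sequences of elements of `V`. -/
def listsOver (V : Set ℕ) : Set (List ℕ) := {l | ∀ c ∈ l, c ∈ V}

theorem sec_listsOver {V : Set ℕ} {c : ℕ} (hc : c ∈ V) : sec (listsOver V) c = listsOver V := by
  ext s
  simp [sec, listsOver, hc]

theorem frequently_mem_of_infinite {V : Set ℕ} (hV : V.Infinite) : ∃ᶠ c in atTop, c ∈ V :=
  Nat.frequently_atTop_iff_infinite.2 hV

theorem not_small_listsOver {V : Set ℕ} (hV : V.Infinite) (sh : Shape) :
    ¬ Small sh (listsOver V) := by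
  induction sh with
  | leaf => simp [Small, listsOver]
  | node f ih =>
    refine not_eventually.2 ((frequently_mem_of_infinite hV).mono fun c hc => ?_)
    rw [sec_listsOver hc]
    exact ih c

theorem good_listsOver {V : Set ℕ} (hV : V.Infinite) (sh : Shape) {l : List ℕ}
    (hl : l ∈ listsOver V) : Good sh (listsOver V) l := by
  induction l generalizing sh with
  | nil => exact good_nil.2 (not_small_listsOver hV sh)
  | cons c l ih =>
    cases sh with
    | leaf => simp [Good, listsOver]
    | node f =>
      have hc : c ∈ V := hl c (by simp)
      rw [Good, sec_listsOver hc]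
      exact ih _ fun d hd => hl d (by simp [hd])

theorem Good.infinite_append {V : Set ℕ} (hV : V.Infinite) {sh : Shape} {Z : Set (List ℕ)}
    {l : List ℕ} (hZ : Z ⊆ listsOver V) (h : Good sh Z l) :
    {c | c ∈ V ∧ Good sh Z (l ++ [c])}.Infinite := by
  induction l generalizing sh Z with
  | nil =>
    cases sh with
    | leaf => simpa [Good, show [] ∈ Z from h] using hV
    | node f =>
      refine Nat.frequently_atTop_iff_infinite.1 ((not_eventually.1 h).mono fun c hc => ⟨?_, ?_⟩)
      · by_contra hcV
        refine hc ((small_empty _).mono fun s hs => ?_)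
        exact hcV (hZ hs c (by simp))
      · exact good_nil.2 hc
  | cons a l ih =>
    cases sh with
    | leaf => simpa [Good, show [] ∈ Z from h] using hV
    | node f => exact ih (fun s hs c hc => hZ hs c (by simp [hc])) h

/-- If all sequences in `X` are good for `Z`, then the leaves in `X` are in `Z`. -/
theorem small_diff_of_good {sh : Shape} {X Z : Set (List ℕ)} (h : ∀ l ∈ X, Good sh Z l) :
    Small sh (X \ Z) := by
  induction sh generalizing X Z with
  | leaf => exact fun hX => hX.2 (h [] hX.1)
  | node f ih => exact Eventually.of_forall fun n => ih n fun l hl => h (n :: l) hl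

/-- Recursive construction of a sequence: `P n` is a condition on the first `n + 1` terms. -/
theorem exists_seq_of_forall_update {β : Type*} (P : ℕ → (ℕ → β) → Prop) (g₀ : ℕ → β)
    (hcongr : ∀ n g g', (∀ k ≤ n, g k = g' k) → P n g → P n g')
    (hstep : ∀ n g, (∀ k < n, P k g) → ∃ a, P n (Function.update g n a)) :
    ∃ g, ∀ n, P n g := by
  classical
  have key : ∀ n (g : ℕ → β), ∃ a, (∀ k < n, P k g) → P n (Function.update g n a) := fun n g => by
    by_cases h : ∀ k < n, P k g
    · exact (hstep n g h).imp fun a ha _ => ha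
    · exact ⟨g₀ 0, fun h' => absurd h' h⟩
  choose a ha using key
  let G : ℕ → ℕ → β := fun n => Nat.rec g₀ (fun n g => Function.update g n (a n g)) n
  have hG : ∀ n, G (n + 1) = Function.update (G n) n (a n (G n)) := fun n => rfl
  have hstab : ∀ n m, n < m → G m n = G (n + 1) n := by
    intro n m hnm
    induction m with
    | zero => omega
    | succ m ih =>
      rcases Nat.lt_succ_iff_lt_or_eq.1 hnm with h | rfl
      · rw [hG m, Function.update_of_ne h.ne, ih h]
      · rfl
  have hP : ∀ n, ∀ k < n, P k (G n) := by
    intro n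
    induction n with
    | zero => intro k hk; omega
    | succ n ih =>
      intro k hk
      rcases Nat.lt_succ_iff_lt_or_eq.1 hk with h | rfl
      · refine hcongr k (G n) _ (fun i hi => ?_) (ih k h)
        rw [hG n, Function.update_of_ne (by omega)]
      · rw [hG]
        exact ha _ _ ih
  exact ⟨fun n => G (n + 1) n, fun n => hcongr n (G (n + 1)) _
    (fun k hk => hstab k (n + 1) (by omega)) (hP (n + 1) n (Nat.lt_succ_self n))⟩

/-- The labels `w k` code pairs, and each pair lies above the previous ones. -/
def IncreasingPairs (w : ℕ → ℕ) : Prop :=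
  (∀ k, (w k).unpair.1 < (w k).unpair.2) ∧ ∀ i k, i < k → (w i).unpair.2 < (w k).unpair.1

theorem IncreasingPairs.le_unpair {w : ℕ → ℕ} (hw : IncreasingPairs w) (k : ℕ) :
    k ≤ (w k).unpair.1 := by
  induction k with
  | zero => exact Nat.zero_le _
  | succ k ih =>
    have h1 := hw.1 k
    have h2 := hw.2 k (k + 1) (Nat.lt_succ_self k)
    omega

theorem IncreasingPairs.le {w : ℕ → ℕ} (hw : IncreasingPairs w) (k : ℕ) : k ≤ w k :=
  (hw.le_unpair k).trans (Nat.unpair_left_le _)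

theorem IncreasingPairs.injective {w : ℕ → ℕ} (hw : IncreasingPairs w) :
    Function.Injective w := by
  intro i j h
  by_contra hne
  rcases Nat.lt_or_gt_of_ne hne with hlt | hlt
  · have h1 := hw.1 i
    have h2 := hw.2 i j hlt
    rw [h] at h1 h2
    omega
  · have h1 := hw.1 i
    have h2 := hw.2 j i hlt
    rw [h] at h1 h2
    omega

/-- Steering. From a given stem of `m` labels, a sequence of labels in `V` can be continued so
that the part of its tree above each label `c` of a successor of the root, except for the labels in
the stem, is contained in a prescribed set `W c`, and that the `i`-th successor of the root has a
label in `H i`. It is enough that `W c` is positive for infinitely many `c ∈ H i`, and that only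
finitely many pairs in `V` start below any given bound. -/
theorem exists_steered_tree (g : ℕ → Shape) (V : Set ℕ)
    (hlt : ∀ c ∈ V, c.unpair.1 < c.unpair.2) (hfin : ∀ N, {c ∈ V | c.unpair.1 ≤ N}.Finite)
    {w₀ : ℕ → ℕ} (hw₀ : IncreasingPairs w₀) (m : ℕ) (hV : ∀ j < m, w₀ j ∈ V)
    (W : ℕ → Set (List ℕ)) (H : ℕ → Set ℕ)
    (hH : ∀ i, {c | c ∈ V ∧ c ∈ H i ∧ ¬ Small (g c) (listsOver V ∩ W c)}.Infinite) :
    ∃ w, (∀ j < m, w j = w₀ j) ∧ (∀ j, w j ∈ V) ∧ IncreasingPairs w ∧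
      (∀ i, m ≤ Nat.pair 0 i → w (Nat.pair 0 i) ∈ H i) ∧
      ∀ c, (∀ j < m, w₀ j ≠ c) → Small (g c) (sec (tree w) c \ W c) := by
  have hVinf : V.Infinite := (hH 0).mono fun c hc => hc.1
  -- above the labels of the stem every sequence is admitted
  let Z : ℕ → Set (List ℕ) := fun c => {l | l ∈ listsOver V ∧ ((∃ j < m, w₀ j = c) ∨ l ∈ W c)}
  let Q : List ℕ → Prop := fun l => ∃ c s, l = c :: s ∧ Good (g c) (Z c) s
  let P : ℕ → (ℕ → ℕ) → Prop := fun j w => (j < m → w j = w₀ j) ∧ w j ∈ V ∧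
    (∀ i < j, (w i).unpair.2 < (w j).unpair.1) ∧ Q (treeNode w (j + 1)) ∧
    (m ≤ j → j.unpair.1 = 0 → w j ∈ H j.unpair.2)
  obtain ⟨w, hw⟩ : ∃ w, ∀ j, P j w := by
    refine exists_seq_of_forall_update P w₀ (fun j w w' h hP => ?_) fun j w hP => ?_
    · have hj := h j le_rfl
      refine ⟨fun hm => hj ▸ hP.1 hm, hj ▸ hP.2.1, fun i hi => ?_, ?_, hj ▸ hP.2.2.2.2⟩
      · rw [← hj, ← h i hi.le]
        exact hP.2.2.1 i hi
      · rw [← treeNode_congr (j + 1) fun i hi => h i (Nat.lt_succ_iff.1 hi)]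
        exact hP.2.2.2.1
    · have hne : ∀ a i, i < j → Function.update w j a i = w i := fun a i hi =>
        Function.update_of_ne hi.ne _ _
      have hnode : ∀ a, treeNode (Function.update w j a) (j + 1) =
          treeNode w j.unpair.1 ++ [a] := fun a => by
        rw [treeNode_succ, Function.update_self,
          treeNode_congr _ fun i hi => hne a i (hi.trans_le (Nat.unpair_left_le j))]
      rcases lt_or_ge j m with hjm | hjm
      · refine ⟨w₀ j, fun _ => Function.update_self .., ?_, fun i hi => ?_, ?_, by omega⟩
        · rw [Function.update_self]
          exact hV j hjm
        · rw [Function.update_self, hne _ i hi, (hP i hi).1 (hi.trans hjm)]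
          exact hw₀.2 i j hi
        · rw [hnode]
          have hlab : ∀ c ∈ treeNode w j.unpair.1 ++ [w₀ j], ∃ i < m, w₀ i = c := by
            intro c hc
            rw [List.mem_append, List.mem_singleton] at hc
            rcases hc with hc | rfl
            · obtain ⟨i, hi, rfl⟩ := treeNode_labels _ _ c hc
              have hij : i < j := hi.trans_le (Nat.unpair_left_le j)
              exact ⟨i, hij.trans hjm, ((hP i hij).1 (hij.trans hjm)).symm⟩
            · exact ⟨j, hjm, rfl⟩
          cases hl : treeNode w j.unpair.1 ++ [w₀ j] with
          | nil => simp at hl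
          | cons c s =>
            rw [hl] at hlab
            have hc := hlab c (by simp)
            have hZ : Z c = listsOver V := by
              ext l
              simp only [Z, Set.mem_ofPred_eq]
              exact ⟨fun h => h.1, fun h => ⟨h, .inl hc⟩⟩
            refine ⟨c, s, rfl, ?_⟩
            rw [hZ]
            refine good_listsOver hVinf _ fun d hd => ?_
            obtain ⟨i, hi, rfl⟩ := hlab d (by simp [hd])
            exact hV i hi
      · -- the pair of the new label has to lie above the previous pairs
        have hext : ∀ S : Set ℕ, S.Infinite → S ⊆ V →
            ∃ a ∈ S, ∀ i < j, (w i).unpair.2 < a.unpair.1 := fun S hS hSV => by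
          obtain ⟨a, haS, ha⟩ := hS.exists_notMem_finite
            (hfin ((Finset.range j).sup fun i => (w i).unpair.2))
          refine ⟨a, haS, fun i hi => ?_⟩
          have h1 : ¬ a.unpair.1 ≤ _ := fun h => ha ⟨hSV haS, h⟩
          have h2 := Finset.le_sup (f := fun i => (w i).unpair.2) (Finset.mem_range.2 hi)
          exact h2.trans_lt (not_le.1 h1)
        rcases Nat.eq_zero_or_pos j.unpair.1 with h0 | h0
        · obtain ⟨a, ⟨haV, haH, haW⟩, ha⟩ := hext _ (hH j.unpair.2) fun c hc => hc.1
          refine ⟨a, by omega, ?_, fun i hi => ?_, ?_, fun _ _ => ?_⟩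
          · rwa [Function.update_self]
          · rw [Function.update_self, hne _ i hi]
            exact ha i hi
          · rw [hnode, h0, treeNode_zero]
            refine ⟨a, [], rfl, good_nil.2 fun h => haW (h.mono ?_)⟩
            exact fun l hl => ⟨hl.1, .inr hl.2⟩
          · rwa [Function.update_self]
        · obtain ⟨p, hp⟩ := Nat.exists_eq_add_of_lt h0
          rw [zero_add] at hp
          have hpj : p < j := by have := Nat.unpair_left_le j; omega
          obtain ⟨c, s, hcs, hgood⟩ := (hP p hpj).2.2.2.1
          obtain ⟨a, ⟨haV, haG⟩, ha⟩ := hext _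
            (hgood.infinite_append hVinf fun l hl => hl.1) fun c hc => hc.1
          refine ⟨a, by omega, ?_, fun i hi => ?_, ?_, fun _ _ => by omega⟩
          · rwa [Function.update_self]
          · rw [Function.update_self, hne _ i hi]
            exact ha i hi
          · rw [hnode, hp, hcs]
            exact ⟨c, s ++ [a], rfl, haG⟩
  refine ⟨w, fun j => (hw j).1, fun j => (hw j).2.1,
    ⟨fun k => hlt _ (hw k).2.1, fun i k h => (hw k).2.2.1 i h⟩, fun i hi => ?_, fun c hc => ?_⟩
  · have := (hw (Nat.pair 0 i)).2.2.2.2 hi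
    rw [Nat.unpair_pair] at this
    exact this rfl
  · refine (small_diff_of_good (Z := Z c) fun l hl => ?_).mono fun l hl => ⟨hl.1, fun h => ?_⟩
    · obtain ⟨k, hk⟩ := hl
      cases k with
      | zero => simp [treeNode_zero] at hk
      | succ k =>
        obtain ⟨c', s, hcs, hgood⟩ := (hw k).2.2.2.1
        rw [hk, List.cons.injEq] at hcs
        obtain ⟨rfl, rfl⟩ := hcs
        exact hgood
    · rcases h.2 with ⟨j, hj, h⟩ | h
      · exact hc j hj h
      · exact hl.2 h

/-! ### Infinite sets as sequences of labels -/

theorem InfSet.infinite_toSet (x : InfSet) : x.toSet.Infinite := x.2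

/-- The increasing enumeration of an infinite set. -/
noncomputable def InfSet.enum (x : InfSet) : ℕ → ℕ := Nat.nth (· ∈ x.toSet)

theorem InfSet.enum_strictMono (x : InfSet) : StrictMono x.enum := Nat.nth_strictMono x.2

theorem InfSet.enum_mem (x : InfSet) (k : ℕ) : x.enum k ∈ x.toSet := Nat.nth_mem_of_infinite x.2 k

theorem InfSet.range_enum (x : InfSet) : Set.range x.enum = x.toSet := Nat.range_nth_of_infinite x.2

/-- An infinite set, read as the sequence of the pairs of its consecutive elements. -/
noncomputable def InfSet.labels (x : InfSet) (k : ℕ) : ℕ :=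
  Nat.pair (x.enum (2 * k)) (x.enum (2 * k + 1))

theorem InfSet.increasingPairs_labels (x : InfSet) : IncreasingPairs x.labels := by
  refine ⟨fun k => ?_, fun i k h => ?_⟩
  · simp only [InfSet.labels, Nat.unpair_pair]
    exact x.enum_strictMono (Nat.lt_succ_self _)
  · simp only [InfSet.labels, Nat.unpair_pair]
    exact x.enum_strictMono (by omega)

/-- The infinite set with a given set of elements. -/
noncomputable def InfSet.ofSet (S : Set ℕ) (hS : S.Infinite) : InfSet :=
  ⟨fun n => @decide (n ∈ S) (Classical.propDecidable _), by simpa using hS⟩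

@[simp] theorem InfSet.toSet_ofSet (S : Set ℕ) (hS : S.Infinite) :
    (InfSet.ofSet S hS).toSet = S := by
  ext n
  simp [InfSet.ofSet, InfSet.toSet]

theorem InfSet.enum_eq {x : InfSet} {u : ℕ → ℕ} (hu : StrictMono u)
    (hx : Set.range u = x.toSet) : x.enum = u :=
  (StrictMono.range_inj x.enum_strictMono hu).1 (x.range_enum.trans hx.symm)

theorem IncreasingPairs.exists_labels_eq {w : ℕ → ℕ} (hw : IncreasingPairs w) :
    ∃ x : InfSet, x.labels = w := by
  let u : ℕ → ℕ := fun n => if n % 2 = 0 then (w (n / 2)).unpair.1 else (w (n / 2)).unpair.2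
  have hu0 : ∀ k, u (2 * k) = (w k).unpair.1 := fun k => by simp [u]
  have hu1 : ∀ k, u (2 * k + 1) = (w k).unpair.2 := fun k => by
    have h1 : (2 * k + 1) % 2 = 1 := by omega
    have h2 : (2 * k + 1) / 2 = k := by omega
    simp [u, h1, h2]
  have hu : StrictMono u := strictMono_nat_of_lt_succ fun n => by
    obtain ⟨k, rfl | rfl⟩ := n.even_or_odd'
    · rw [hu0, hu1]
      exact hw.1 k
    · rw [hu1, show 2 * k + 1 + 1 = 2 * (k + 1) by ring, hu0]
      exact hw.2 k (k + 1) (Nat.lt_succ_self k)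
  let x := InfSet.ofSet (Set.range u) (Set.infinite_range_of_injective hu.injective)
  have hx : x.toSet = Set.range u := InfSet.toSet_ofSet _ _
  have hxu : x.enum = u := InfSet.enum_eq hu hx.symm
  exact ⟨x, funext fun k => by rw [InfSet.labels, hxu, hu0, hu1, Nat.pair_unpair]⟩

theorem InfSet.mem_toSet_iff_labels (x : InfSet) (n : ℕ) :
    n ∈ x.toSet ↔ ∃ k, n = (x.labels k).unpair.1 ∨ n = (x.labels k).unpair.2 := by
  simp only [InfSet.labels, Nat.unpair_pair]
  rw [← x.range_enum]
  constructor
  · rintro ⟨n, rfl⟩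
    obtain ⟨k, rfl | rfl⟩ := n.even_or_odd'
    · exact ⟨k, .inl rfl⟩
    · exact ⟨k, .inr rfl⟩
  · rintro ⟨k, rfl | rfl⟩
    · exact ⟨_, rfl⟩
    · exact ⟨_, rfl⟩

/-- The stem `s` is the set of the first elements of the members of `[s, A]^∞`. -/
theorem image_enum_range_card {s : Finset ℕ} {A x : InfSet} (hsA : Below s A)
    (hx : x ∈ ellentuck s A) : (Finset.range s.card).image x.enum = s := by
  refine Finset.eq_of_subset_of_card_le (fun n hn => ?_) ?_
  · obtain ⟨k, hk, rfl⟩ := Finset.mem_image.1 hn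
    rw [Finset.mem_range] at hk
    by_contra hks
    have hkA : x.enum k ∈ A.toSet := (hx.2 (x.enum_mem k)).resolve_left hks
    have hsub : s ⊆ (Finset.range k).image x.enum := fun i hi => by
      have hi' : i ∈ x.toSet := hx.1 hi
      rw [← x.range_enum] at hi'
      obtain ⟨j, rfl⟩ := hi'
      refine Finset.mem_image_of_mem _ (Finset.mem_range.2 ?_)
      exact x.enum_strictMono.lt_iff_lt.1 (hsA _ hi _ hkA)
    have := (Finset.card_le_card hsub).trans Finset.card_image_le
    rw [Finset.card_range] at this
    omega
  · rw [Finset.card_image_of_injective _ x.enum_strictMono.injective, Finset.card_range]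

theorem ellentuck_of_labels {s : Finset ℕ} {A x z : InfSet} (hsA : Below s A)
    (hx : x ∈ ellentuck s A) {m : ℕ} (hs : s.card = 2 * m)
    (hz : ∀ j < m, z.labels j = x.labels j)
    (hzA : ∀ j, (z.labels j).unpair.1 ∈ (s : Set ℕ) ∪ A.toSet ∧
      (z.labels j).unpair.2 ∈ (s : Set ℕ) ∪ A.toSet) : z ∈ ellentuck s A := by
  refine ⟨fun n hn => ?_, fun n hn => ?_⟩
  · have h := image_enum_range_card hsA hx
    rw [hs] at h
    have hn' : n ∈ (Finset.range (2 * m)).image x.enum := h.symm ▸ hn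
    obtain ⟨i, hi, rfl⟩ := Finset.mem_image.1 hn'
    rw [Finset.mem_range] at hi
    rw [z.mem_toSet_iff_labels]
    obtain ⟨k, rfl | rfl⟩ := i.even_or_odd'
    · refine ⟨k, .inl ?_⟩
      rw [hz k (by omega), InfSet.labels, Nat.unpair_pair]
    · refine ⟨k, .inr ?_⟩
      rw [hz k (by omega), InfSet.labels, Nat.unpair_pair]
  · obtain ⟨k, rfl | rfl⟩ := (z.mem_toSet_iff_labels n).1 hn
    · exact (hzA k).1
    · exact (hzA k).2

theorem ellentuck_mono {s : Finset ℕ} {A B : InfSet} (h : B.toSet ⊆ A.toSet) :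
    ellentuck s B ⊆ ellentuck s A :=
  fun _ hx => ⟨hx.1, hx.2.trans (Set.union_subset_union_right _ h)⟩

theorem ellentuck_nonempty (s : Finset ℕ) (A : InfSet) : (ellentuck s A).Nonempty := by
  refine ⟨InfSet.ofSet ((s : Set ℕ) ∪ A.toSet) (A.infinite_toSet.mono Set.subset_union_right), ?_⟩
  simp [ellentuck]

/-- Every Ellentuck-basic open set contains one with a stem of even size. -/
theorem exists_even_stem {s : Finset ℕ} {A : InfSet} (hsA : Below s A) :
    ∃ (t : Finset ℕ) (B : InfSet) (m : ℕ), Below t B ∧ ellentuck t B ⊆ ellentuck s A ∧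
      t.card = 2 * m := by
  obtain ⟨m, hm | hm⟩ := s.card.even_or_odd'
  · exact ⟨s, A, m, hsA, subset_rfl, hm⟩
  · obtain ⟨a, ha⟩ := A.infinite_toSet.nonempty
    have hinf : (A.toSet \ Set.Iic a).Infinite := A.infinite_toSet.sdiff (Set.finite_Iic a)
    have has : a ∉ s := fun h => lt_irrefl _ (hsA a h a ha)
    refine ⟨insert a s, InfSet.ofSet _ hinf, m + 1, fun i hi j hj => ?_, fun x hx => ⟨?_, ?_⟩, ?_⟩
    · rw [InfSet.toSet_ofSet] at hj
      rcases Finset.mem_insert.1 hi with rfl | hi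
      · exact not_le.1 hj.2
      · exact hsA i hi j hj.1
    · exact fun n hn => hx.1 (by simp at hn ⊢; exact .inr hn)
    · refine hx.2.trans ?_
      rw [InfSet.toSet_ofSet]
      rintro n (hn | hn)
      · rcases Finset.mem_insert.1 hn with rfl | hn
        · exact .inr ha
        · exact .inl hn
      · exact .inr hn.1
    · rw [Finset.card_insert_of_notMem has, hm]
      ring

/-! ### Measurability -/

/-- A set of infinite sets that only depends on the elements below `N` is Borel. -/
theorem measurableSet_of_locally_determined {P : Set InfSet} (N : ℕ)
    (h : ∀ x x' : InfSet, (∀ i < N, x.1 i = x'.1 i) → x ∈ P → x' ∈ P) : MeasurableSet P := by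
  let r : InfSet → Fin N → Bool := fun x i => x.1 i
  have hr : Measurable r := measurable_pi_lambda _ fun i =>
    (measurable_pi_apply (i : ℕ)).comp measurable_subtype_coe
  have : P = r ⁻¹' (r '' P) := by
    refine (Set.subset_preimage_image r P).antisymm fun x' hx' => ?_
    obtain ⟨x, hx, hxx⟩ := hx'
    exact h x x' (fun i hi => congrFun hxx ⟨i, hi⟩) hx
  rw [this]
  exact hr (Set.toFinite _).measurableSet

theorem measurableSet_mem_toSet (n : ℕ) : MeasurableSet {x : InfSet | n ∈ x.toSet} :=
  measurableSet_of_locally_determined (n + 1) fun x x' h hx => by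
    have := h n (Nat.lt_succ_self n)
    simp only [InfSet.toSet, Set.mem_ofPred_eq] at hx ⊢
    rw [← this, hx]

theorem measurableSet_ellentuck (s : Finset ℕ) (A : InfSet) :
    MeasurableSet (ellentuck s A) := by
  have : ellentuck s A = (⋂ n ∈ s, {x : InfSet | n ∈ x.toSet}) ∩
      ⋂ n, ⋂ (_ : n ∉ (s : Set ℕ) ∪ A.toSet), {x : InfSet | n ∈ x.toSet}ᶜ := by
    ext x
    simp only [ellentuck, Set.mem_inter_iff, Set.mem_ofPred_eq, Set.mem_iInter,
      Set.mem_compl_iff]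
    exact and_congr Iff.rfl (forall_congr' fun n => not_imp_not.symm)
  rw [this]
  exact .inter (.biInter s.countable_toSet fun n _ => measurableSet_mem_toSet n)
    (.iInter fun n => .iInter fun _ => (measurableSet_mem_toSet n).compl)

theorem InfSet.enum_eq_iff (x : InfSet) (k a : ℕ) :
    x.enum k = a ↔ a ∈ x.toSet ∧ {n ∈ Finset.range a | x.1 n = true}.card = k := by
  classical
  have hc : {n ∈ Finset.range a | x.1 n = true}.card = Nat.count (· ∈ x.toSet) a := by
    rw [Nat.count_eq_card_filter_range]
    refine congrArg Finset.card (Finset.ext fun n => ?_)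
    rw [Finset.mem_filter, Finset.mem_filter]
    exact Iff.rfl
  rw [hc]
  constructor
  · rintro rfl
    exact ⟨x.enum_mem k, Nat.count_nth_of_infinite (p := (· ∈ x.toSet)) x.2 k⟩
  · rintro ⟨h, rfl⟩
    exact Nat.nth_count (p := (· ∈ x.toSet)) h

theorem measurableSet_enum_eq (k a : ℕ) : MeasurableSet {x : InfSet | x.enum k = a} := by
  refine measurableSet_of_locally_determined (a + 1) fun x x' h hx => ?_
  rw [Set.mem_ofPred_eq, InfSet.enum_eq_iff] at hx ⊢
  refine ⟨?_, ?_⟩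
  · have h1 := hx.1
    simp only [InfSet.toSet, Set.mem_ofPred_eq] at h1 ⊢
    rw [← h a (Nat.lt_succ_self a), h1]
  · rw [← hx.2]
    congr 1
    refine Finset.filter_congr fun n hn => ?_
    rw [h n ((Finset.mem_range.1 hn).trans (Nat.lt_succ_self a))]

theorem measurableSet_labels_eq (k c : ℕ) : MeasurableSet {x : InfSet | x.labels k = c} := by
  have : {x : InfSet | x.labels k = c} = {x | x.enum (2 * k) = c.unpair.1} ∩
      {x | x.enum (2 * k + 1) = c.unpair.2} := by
    ext x
    simp only [InfSet.labels, Set.mem_inter_iff, Set.mem_ofPred_eq]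
    constructor
    · rintro rfl
      simp
    · rintro ⟨h1, h2⟩
      rw [h1, h2, Nat.pair_unpair]
  rw [this]
  exact (measurableSet_enum_eq _ _).inter (measurableSet_enum_eq _ _)

theorem measurableSet_treeNode_eq (k : ℕ) (l : List ℕ) :
    MeasurableSet {x : InfSet | treeNode x.labels k = l} := by
  induction k using Nat.strong_induction_on generalizing l with
  | _ k ih =>
    cases k with
    | zero => simp only [treeNode_zero]; exact .const _
    | succ k =>
      have : {x : InfSet | treeNode x.labels (k + 1) = l} = ⋃ (l' : List ℕ) (c : ℕ)
          (_ : l' ++ [c] = l), {x | treeNode x.labels k.unpair.1 = l'} ∩ {x | x.labels k = c} := by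
        ext x
        simp [treeNode_succ]
      rw [this]
      exact .iUnion fun l' => .iUnion fun c => .iUnion fun _ =>
        (ih _ (Nat.lt_succ_of_le (Nat.unpair_left_le k)) l').inter (measurableSet_labels_eq k c)

theorem measurableSet_mem_tree (l : List ℕ) :
    MeasurableSet {x : InfSet | l ∈ tree x.labels} := by
  have : {x : InfSet | l ∈ tree x.labels} = ⋃ k, {x | treeNode x.labels k = l} := by
    ext x
    simp [tree]
  rw [this]
  exact .iUnion fun k => measurableSet_treeNode_eq k l

/-! ### Countably many completely Ramsey sets -/

/-- Finitely many stems can be decided at once. -/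
theorem exists_decides_of_finset {P : Set InfSet} (hP : CompletelyRamsey P) (A : InfSet)
    (T : Finset (Finset ℕ)) (hT : ∀ t ∈ T, Below t A) :
    ∃ B : InfSet, B.toSet ⊆ A.toSet ∧ ∀ t ∈ T, ellentuck t B ⊆ P ∨ ellentuck t B ⊆ Pᶜ := by
  classical
  induction T using Finset.induction_on with
  | empty => exact ⟨A, subset_rfl, by simp⟩
  | insert t T _ ih =>
    obtain ⟨B, hBA, hB⟩ := ih fun t' ht' => hT t' (Finset.mem_insert_of_mem ht')
    obtain ⟨C, hCB, hC⟩ := hP t B fun i hi j hj =>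
      hT t (Finset.mem_insert_self t T) i hi j (hBA hj)
    refine ⟨C, hCB.trans hBA, fun t' ht' => ?_⟩
    rcases Finset.mem_insert.1 ht' with rfl | ht'
    · exact hC
    · exact (hB t' ht').imp (ellentuck_mono hCB).trans (ellentuck_mono hCB).trans

/-- Fusion: countably many completely Ramsey sets become open and closed, in the topology of the
Cantor space, on a common Ellentuck-basic open set. -/
theorem exists_locally_determined {P : ℕ → Set InfSet} (hP : ∀ k, CompletelyRamsey (P k))
    {s : Finset ℕ} {A : InfSet} (hsA : Below s A) :
    ∃ B : InfSet, B.toSet ⊆ A.toSet ∧ ∀ k, ∃ N, ∀ x ∈ ellentuck s B, ∀ x' ∈ ellentuck s B,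
      (∀ i < N, x.1 i = x'.1 i) → x ∈ P k → x' ∈ P k := by
  classical
  let St := {C : InfSet // Below s C}
  have hstep : ∀ (k : ℕ) (C : St), ∃ (b : ℕ) (D : St), b ∈ C.1.toSet ∧ D.1.toSet ⊆ C.1.toSet ∧
      (∀ j ∈ D.1.toSet, b < j) ∧ ∀ t ⊆ Finset.range (b + 1),
        ellentuck (s ∪ t) D.1 ⊆ P k ∨ ellentuck (s ∪ t) D.1 ⊆ (P k)ᶜ := fun k C => by
    obtain ⟨b, hb⟩ := C.1.infinite_toSet.nonempty
    have hinf : (C.1.toSet \ Set.Iic b).Infinite := C.1.infinite_toSet.sdiff (Set.finite_Iic b)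
    obtain ⟨D, hDC, hD⟩ := exists_decides_of_finset (hP k) (InfSet.ofSet _ hinf)
      ((Finset.range (b + 1)).powerset.image fun t => s ∪ t) (by
        intro t' ht' i hi j hj
        obtain ⟨t, ht, rfl⟩ := Finset.mem_image.1 ht'
        rw [InfSet.toSet_ofSet] at hj
        rcases Finset.mem_union.1 hi with hi | hi
        · exact C.2 i hi j hj.1
        · have h1 := Finset.mem_range.1 (Finset.mem_powerset.1 ht hi)
          have h2 : b < j := not_le.1 hj.2
          exact (Nat.lt_succ_iff.1 h1).trans_lt h2)
    rw [InfSet.toSet_ofSet] at hDC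
    refine ⟨b, ⟨D, fun i hi j hj => C.2 i hi j (hDC hj).1⟩, hb, fun j hj => (hDC hj).1,
      fun j hj => not_le.1 (hDC hj).2, fun t ht => ?_⟩
    exact hD _ (Finset.mem_image_of_mem _ (Finset.mem_powerset.2 ht))
  choose b D hb hDC hbD hD using hstep
  let E : ℕ → St := fun n => Nat.rec ⟨A, hsA⟩ (fun k C => D k C) n
  have hE : ∀ n, E (n + 1) = D n (E n) := fun n => rfl
  have hanti : ∀ n m, n ≤ m → (E m).1.toSet ⊆ (E n).1.toSet := fun n m h => by
    induction m, h using Nat.le_induction with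
    | base => exact subset_rfl
    | succ m _ ih => exact (hE m ▸ hDC m (E m)).trans ih
  let c : ℕ → ℕ := fun n => b n (E n)
  have hcE : ∀ n, c n ∈ (E n).1.toSet := fun n => hb n (E n)
  have hc : StrictMono c := strictMono_nat_of_lt_succ fun n =>
    hbD n (E n) _ (hE n ▸ hcE (n + 1))
  obtain ⟨B, hB⟩ : ∃ B : InfSet, B.toSet = Set.range c :=
    ⟨_, InfSet.toSet_ofSet _ (Set.infinite_range_of_injective hc.injective)⟩
  refine ⟨B, ?_, fun k => ⟨c k + 1, fun x hx x' hx' hxx hxP => ?_⟩⟩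
  · rw [hB]
    rintro _ ⟨n, rfl⟩
    exact hanti 0 n (Nat.zero_le n) (hcE n)
  · let t : InfSet → Finset ℕ := fun y => {i ∈ Finset.range (c k + 1) | y.1 i = true}
    have ht : ∀ y ∈ ellentuck s B,
        y ∈ ellentuck (s ∪ t y) (E (k + 1)).1 := fun y hy => by
      rw [ellentuck, Set.mem_ofPred_eq, hB] at hy
      refine ⟨fun i hi => ?_, fun i hi => ?_⟩
      · rcases Finset.mem_union.1 hi with hi | hi
        · exact hy.1 hi
        · exact (Finset.mem_filter.1 hi).2
      · rcases hy.2 hi with his | ⟨j, rfl⟩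
        · exact .inl (Finset.mem_union_left _ his)
        · rcases le_or_gt j k with hjk | hjk
          · refine .inl (Finset.mem_union_right _ (Finset.mem_filter.2 ⟨?_, hi⟩))
            exact Finset.mem_range.2 (Nat.lt_succ_of_le (hc.monotone hjk))
          · exact .inr (hanti (k + 1) j hjk (hcE j))
    have htt : t x = t x' := Finset.filter_congr fun i hi => by
      rw [hxx i (Finset.mem_range.1 hi)]
    have h1 := ht x hx
    have h2 := ht x' hx'
    rw [← htt] at h2
    rcases hD k (E k) (t x) (Finset.filter_subset _ _) with h | h
    · exact h h2
    · exact absurd hxP (h h1)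

/-! ### Uniformisation and the Ramsey property against a maximal family -/

theorem tree_subset_listsOver (w : ℕ → ℕ) : tree w ⊆ listsOver (Set.range w) := by
  rintro _ ⟨k, rfl⟩ c hc
  obtain ⟨i, _, h⟩ := treeNode_labels w k c hc
  exact ⟨i, h⟩

theorem listsOver_mono {V V' : Set ℕ} (h : V ⊆ V') : listsOver V ⊆ listsOver V' :=
  fun _ hl c hc => h (hl c hc)

theorem eventually_ne_of_lt (w : ℕ → ℕ) (m : ℕ) : ∀ᶠ c in atTop, ∀ j < m, w j ≠ c :=
  (eventually_all_finite (Set.finite_Iio m)).2 fun j _ =>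
    (eventually_ne_atTop (w j)).mono fun _ h => h.symm

theorem IncreasingPairs.finite_le {w : ℕ → ℕ} (hw : IncreasingPairs w) (N : ℕ) :
    {c ∈ Set.range w | c.unpair.1 ≤ N}.Finite := by
  refine ((Set.finite_Iic N).image w).subset ?_
  rintro _ ⟨⟨j, rfl⟩, hj⟩
  exact ⟨j, (hw.le_unpair j).trans hj, rfl⟩

/-- If `Y` is positive on the tree of `w`, then infinitely many of its columns are positive on the
sequences of labels of `w`. -/
theorem infinite_columns {g : ℕ → Shape} {w : ℕ → ℕ} {Y : Set (List ℕ)}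
    (h : ¬ Small (.node g) (Y ∩ tree w)) :
    {c | c ∈ Set.range w ∧
      ¬ Small (g c) (listsOver (Set.range w) ∩ sec Y c)}.Infinite := by
  refine Nat.frequently_atTop_iff_infinite.1 ((not_eventually.1 h).mono fun c hc => ⟨?_, ?_⟩)
  · by_contra hcV
    refine hc ((small_empty _).mono fun s hs => ?_)
    exact hcV (tree_subset_listsOver w hs.2 c (by simp))
  · exact fun h => hc (h.mono fun s hs =>
      ⟨fun d hd => tree_subset_listsOver w hs.2 d (by simp [hd]), hs.1⟩)

theorem Pointclass.mem_of_measurableSet (Γ : Pointclass) {X : Type} [TopologicalSpace X]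
    [PolishSpace X] [MeasurableSpace X] [BorelSpace X] {B : Set X} (hB : MeasurableSet B) :
    Γ.mem X B := by
  refine Γ.borel_mem X B ?_
  rwa [← BorelSpace.measurable_eq (α := X)]

/-- Thinning: a positive intersection of `Y` with the tree of `x` is turned into inclusion. -/
theorem exists_tree_subset {g : ℕ → Shape} {s : Finset ℕ} {C x : InfSet} (hsC : Below s C)
    {m : ℕ} (hs : s.card = 2 * m) (hx : x ∈ ellentuck s C) {Y : Set (List ℕ)}
    (hY : ¬ Small (.node g) (Y ∩ tree x.labels)) :
    ∃ z ∈ ellentuck s C, Small (.node g) (tree z.labels \ Y) := by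
  have hinc := x.increasingPairs_labels
  obtain ⟨w, hwm, hwV, hw, -, hsmall⟩ := exists_steered_tree g (Set.range x.labels)
    (by rintro _ ⟨k, rfl⟩; exact hinc.1 k) hinc.finite_le hinc m
    (fun j _ => ⟨j, rfl⟩) (fun c => sec Y c) (fun _ => Set.univ)
    (fun i => (infinite_columns hY).mono fun c hc => ⟨hc.1, trivial, hc.2⟩)
  obtain ⟨z, hzw⟩ := hw.exists_labels_eq
  refine ⟨z, ellentuck_of_labels hsC hx hs (fun j hj => hzw ▸ hwm j hj) fun j => ?_, ?_⟩
  · rw [hzw]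
    obtain ⟨k, hk⟩ := hwV j
    rw [← hk]
    exact ⟨hx.2 ((x.mem_toSet_iff_labels _).2 ⟨k, .inl rfl⟩),
      hx.2 ((x.mem_toSet_iff_labels _).2 ⟨k, .inr rfl⟩)⟩
  · rw [hzw]
    filter_upwards [eventually_ne_of_lt x.labels m] with c hc
    exact hsmall c hc

/-- Splitting: if `Y` is positive on the tree of `x`, but the columns `pair n i` of `Y` are small
for almost all `i`, whenever `n ≠ n₀`, then `Y` splits some tree into two positive parts. The even
successors of the root get labels of columns in which `Y` is small, and the odd ones labels of
columns in which `Y` is positive. -/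
theorem exists_tree_split {g : ℕ → Shape} {s : Finset ℕ} {C x : InfSet} (hsC : Below s C)
    {m : ℕ} (hs : s.card = 2 * m) (hx : x ∈ ellentuck s C) {Y : Set (List ℕ)}
    (hY : ¬ Small (.node g) (Y ∩ tree x.labels)) {n₀ : ℕ}
    (hcol : ∀ n ≠ n₀, ∀ᶠ i in atTop, Small (g (Nat.pair n i)) (sec Y (Nat.pair n i))) :
    ∃ z ∈ ellentuck s C, ¬ Small (.node g) (tree z.labels ∩ Y) ∧
      ¬ Small (.node g) (tree z.labels \ Y) := by
  have hinc := x.increasingPairs_labels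
  have hex : ∀ a, ∃ b, a ≠ n₀ → a < b ∧ b ∈ C.toSet ∧
      Small (g (Nat.pair a b)) (sec Y (Nat.pair a b)) := fun a => by
    by_cases ha : a = n₀
    · exact ⟨0, fun h => absurd ha h⟩
    · obtain ⟨b, hbC, hb⟩ := ((frequently_mem_of_infinite C.infinite_toSet).and_eventually
        ((hcol a ha).and (eventually_gt_atTop a))).exists
      exact ⟨b, fun _ => ⟨hb.2, hbC, hb.1⟩⟩
  choose β hβ using hex
  -- labels of columns in which `Y` is small
  let V₂ : Set ℕ := (fun a => Nat.pair a (β a)) '' (C.toSet \ {n₀})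
  have hV₂ : ∀ c ∈ V₂, c.unpair.1 < c.unpair.2 ∧ c.unpair.1 ∈ C.toSet ∧ c.unpair.2 ∈ C.toSet ∧
      Small (g c) (sec Y c) := by
    rintro _ ⟨a, ⟨haC, ha⟩, rfl⟩
    obtain ⟨h1, h2, h3⟩ := hβ a ha
    simpa using ⟨h1, haC, h2, h3⟩
  have hV₂inf : V₂.Infinite := by
    refine (C.infinite_toSet.sdiff (Set.finite_singleton n₀)).image fun a _ b _ h => ?_
    exact (Nat.pair_eq_pair.1 h).1
  let V : Set ℕ := Set.range x.labels ∪ V₂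
  have hVinf : V.Infinite := hV₂inf.mono Set.subset_union_right
  have hVlt : ∀ c ∈ V, c.unpair.1 < c.unpair.2 := by
    rintro c (⟨k, rfl⟩ | hc)
    · exact hinc.1 k
    · exact (hV₂ c hc).1
  have hVfin : ∀ N, {c ∈ V | c.unpair.1 ≤ N}.Finite := fun N => by
    refine ((hinc.finite_le N).union
      ((Set.finite_Iic N).image fun a => Nat.pair a (β a))).subset ?_
    rintro c ⟨hc | ⟨a, ha, rfl⟩, hcN⟩
    · exact .inl ⟨hc, hcN⟩
    · exact .inr ⟨a, by simpa using hcN, rfl⟩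
  let W : ℕ → Set (List ℕ) := fun c => {l | c ∈ V₂ ↔ c :: l ∉ Y}
  obtain ⟨w, hwm, hwV, hw, hwH, hsmall⟩ := exists_steered_tree g V hVlt hVfin hinc m
    (fun j _ => .inl ⟨j, rfl⟩) W (fun i => {c | c ∈ V₂ ↔ Even i}) (fun i => by
      by_cases hi : Even i
      · refine hV₂inf.mono fun c hc => ⟨.inr hc, iff_of_true hc hi, fun h => ?_⟩
        refine not_small_listsOver hVinf (g c) ((h.union (hV₂ c hc).2.2.2).mono fun l hl => ?_)
        by_cases hlY : c :: l ∈ Y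
        · exact .inr hlY
        · exact .inl ⟨hl, iff_of_true hc hlY⟩
      · refine (infinite_columns hY).mono fun c hc => ?_
        have hc₂ : c ∉ V₂ := fun h =>
          hc.2 ((hV₂ c h).2.2.2.mono Set.inter_subset_right)
        refine ⟨.inl hc.1, iff_of_false hc₂ hi, fun h => hc.2 (h.mono fun l hl => ?_)⟩
        exact ⟨listsOver_mono Set.subset_union_left hl.1, iff_of_false hc₂ (not_not.2 hl.2)⟩)
  obtain ⟨z, hzw⟩ := hw.exists_labels_eq
  have key : ∀ i, m ≤ Nat.pair 0 i →
      ¬ Small (g (w (Nat.pair 0 i)))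
        (sec (tree w) (w (Nat.pair 0 i)) ∩ W (w (Nat.pair 0 i))) := fun i hi h => by
    refine not_small_sec_tree hw.le (g (w (Nat.pair 0 i))) i ((h.union (hsmall _ ?_)).mono ?_)
    · intro j hj he
      rw [← hwm j hj] at he
      have := hw.injective he
      omega
    · exact fun l hl => or_iff_not_imp_left.2 fun hlW => ⟨hl, fun h' => hlW ⟨hl, h'⟩⟩
  have hlarge : ∀ᶠ i in atTop, m ≤ Nat.pair 0 i :=
    (eventually_ge_atTop m).mono fun i hi => hi.trans (Nat.right_le_pair 0 i)
  have htend := tendsto_atTop_comp_pair hw.le 0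
  refine ⟨z, ellentuck_of_labels hsC hx hs (fun j hj => hzw ▸ hwm j hj) fun j => ?_, ?_, ?_⟩
  · rw [hzw]
    rcases hwV j with ⟨k, hk⟩ | hc
    · rw [← hk]
      exact ⟨hx.2 ((x.mem_toSet_iff_labels _).2 ⟨k, .inl rfl⟩),
        hx.2 ((x.mem_toSet_iff_labels _).2 ⟨k, .inr rfl⟩)⟩
    · exact ⟨.inr (hV₂ _ hc).2.1, .inr (hV₂ _ hc).2.2.1⟩
  · rw [hzw]
    intro h
    obtain ⟨i, hi, him, his⟩ := (Nat.frequently_odd.and_eventually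
      (hlarge.and (htend.eventually h))).exists
    have hc : w (Nat.pair 0 i) ∉ V₂ := fun h =>
      Nat.not_even_iff_odd.2 hi ((hwH i him).1 h)
    exact key i him (his.mono fun l hl => ⟨hl.1, not_not.1 fun h => hc (hl.2.2 h)⟩)
  · rw [hzw]
    intro h
    obtain ⟨i, hi, him, his⟩ := (Nat.frequently_even.and_eventually
      (hlarge.and (htend.eventually h))).exists
    have hc : w (Nat.pair 0 i) ∈ V₂ := (hwH i him).2 hi
    exact key i him (his.mono fun l hl => ⟨hl.1, hl.2.1 hc⟩)

/-- The subset of a countable set coded by a point of `[ℕ]^∞`. The odd numbers are free, so that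
every subset, finite or not, has a code. -/
def codedSet (S : Type) [Encodable S] (y : InfSet) : Set S :=
  {i | y.1 (2 * Encodable.encode i) = true}

theorem codedSet_surjective (S : Type) [Encodable S] : Function.Surjective (codedSet S) := by
  intro X
  have hinf : {n | Odd n ∨ ∃ i ∈ X, 2 * Encodable.encode i = n}.Infinite :=
    (Nat.frequently_atTop_iff_infinite.1 Nat.frequently_odd).mono fun n hn => .inl hn
  refine ⟨InfSet.ofSet _ hinf, ?_⟩
  have h := InfSet.toSet_ofSet _ hinf
  ext i
  change 2 * Encodable.encode i ∈ (InfSet.ofSet _ hinf).toSet ↔ _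
  rw [h]
  constructor
  · rintro (ho | ⟨j, hj, he⟩)
    · exact absurd (even_two_mul _) (Nat.not_even_iff_odd.2 ho)
    · rwa [← Encodable.encode_injective (Nat.mul_left_cancel two_pos he)]
  · exact fun hi => .inr ⟨i, hi, rfl⟩

/-- A family `𝒜` in the pointclass, seen through `φ` as a family of sets of sequences, cannot be
maximal almost disjoint with respect to the ideal of a shape if each of its members meets almost
all the columns `pair n i` in small sets, for all `n` but one. -/
theorem no_maximal_family (Γ Γ' : Pointclass)
    (hΓ' : ∀ P : Set InfSet, Γ'.mem InfSet P → CompletelyRamsey P)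
    (hunif : ∀ R : Set (InfSet × InfSet), Γ.mem (InfSet × InfSet) R → (∀ x, ∃ y, (x, y) ∈ R) →
      ∃ (s : Finset ℕ) (A : InfSet) (f : ellentuck s A → InfSet),
        Below s A ∧ Uniformises R (ellentuck s A) f ∧ Γ'.MeasurableFun (ellentuck s A) f)
    {S : Type} [Countable S] {𝒜 : Set (Set S)} (hΓ : Γ.HasFamily 𝒜) (g : ℕ → Shape)
    (φ : List ℕ → Option S)
    (had : ∀ y ∈ 𝒜, ∀ y' ∈ 𝒜, y ≠ y' → Small (.node g) {l | ∃ i ∈ y ∩ y', φ l = some i})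
    (hmad : ∀ Z, ¬ Small (.node g) Z →
      ∃ y ∈ 𝒜, ¬ Small (.node g) ({l | ∃ i ∈ y, φ l = some i} ∩ Z))
    (hcol : ∀ y ∈ 𝒜, ∃ n₀, ∀ n ≠ n₀, ∀ᶠ i in atTop,
      Small (g (Nat.pair n i)) (sec {l | ∃ i ∈ y, φ l = some i} (Nat.pair n i))) : False := by
  classical
  let _ := Encodable.ofCountable S
  let ψ : InfSet → Set (List ℕ) := fun y => {l | ∃ i ∈ codedSet S y, φ l = some i}
  have hψmem : ∀ y l, l ∈ ψ y ↔ ∃ i, φ l = some i ∧ y.1 (2 * Encodable.encode i) = true :=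
    fun y l => exists_congr fun i => and_comm
  let R : Set (InfSet × InfSet) := {p | codedSet S p.2 ∈ 𝒜} ∩
    {p | ¬ Small (.node g) (ψ p.2 ∩ tree p.1.labels)}
  have hR : Γ.mem (InfSet × InfSet) R := by
    refine Γ.inter_mem _ _ _ ?_ (Γ.mem_of_measurableSet ?_)
    · refine Γ.preimage_mem (InfSet × InfSet) (S → Bool)
        (fun p i => p.2.1 (2 * Encodable.encode i)) _ ?_ hΓ
      exact continuous_pi fun i =>
        (continuous_apply _).comp (continuous_subtype_val.comp continuous_snd)
    · refine (measurableSet_small (.node g)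
        (fun p : InfSet × InfSet => ψ p.2 ∩ tree p.1.labels) fun l => ?_).compl
      have : {p : InfSet × InfSet | l ∈ ψ p.2} = ⋃ (i : S) (_ : φ l = some i),
          Prod.snd ⁻¹' {y : InfSet | 2 * Encodable.encode i ∈ y.toSet} := by
        ext p
        simp [hψmem, InfSet.toSet]
      change MeasurableSet ({p : InfSet × InfSet | l ∈ ψ p.2} ∩
        Prod.fst ⁻¹' {x : InfSet | l ∈ tree x.labels})
      rw [this]
      exact .inter (.iUnion fun i => .iUnion fun _ => measurable_snd (measurableSet_mem_toSet _))
        (measurable_fst (measurableSet_mem_tree l))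
  obtain ⟨s₀, A₀, f, hs₀, hfR, hfm⟩ := hunif R hR fun x => by
    obtain ⟨y, hy, hyx⟩ := hmad _ (not_small_tree x.increasingPairs_labels.le (.node g))
    obtain ⟨c, rfl⟩ := codedSet_surjective S y
    exact ⟨c, hy, hyx⟩
  obtain ⟨s, A, m, hsA, hsub, hm⟩ := exists_even_stem hs₀
  let F : InfSet → InfSet := fun x => if h : x ∈ ellentuck s₀ A₀ then f ⟨x, h⟩ else x
  have hF : ∀ x (h : x ∈ ellentuck s₀ A₀), F x = f ⟨x, h⟩ := fun x h => dif_pos h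
  have hFR : ∀ x ∈ ellentuck s A, codedSet S (F x) ∈ 𝒜 ∧
      ¬ Small (.node g) (ψ (F x) ∩ tree x.labels) := fun x hx => by
    rw [hF x (hsub hx)]
    exact hfR ⟨x, hsub hx⟩
  have huniq : ∀ x ∈ ellentuck s A, ∀ z ∈ ellentuck s A,
      ¬ Small (.node g) (ψ (F x) ∩ ψ (F z)) → ψ (F x) = ψ (F z) := fun x hx z hz h => by
    by_cases hne : codedSet S (F x) = codedSet S (F z)
    · simp only [ψ, hne]
    · refine absurd ((had _ (hFR x hx).1 _ (hFR z hz).1 hne).mono ?_) h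
      rintro l ⟨⟨i, hi, hil⟩, j, hj, hjl⟩
      obtain rfl : i = j := Option.some_injective _ (hil.symm.trans hjl)
      exact ⟨i, ⟨hi, hj⟩, hil⟩
  have hbit : ∀ k, IsOpen {y : InfSet | y.1 k = true} := fun k => by
    have hc : Continuous fun y : InfSet => y.1 k :=
      (continuous_apply k).comp continuous_subtype_val
    exact (isOpen_discrete ({true} : Set Bool)).preimage hc
  obtain ⟨B, hBA, hB⟩ := exists_locally_determined
    (P := fun k => Subtype.val '' (f ⁻¹' {y | y.1 k = true})) (fun k => hΓ' _ (hfm _ (hbit k))) hsA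
  have hsubB := ellentuck_mono (s := s) hBA
  have hFbit : ∀ k, MeasurableSet {x | x ∈ ellentuck s B ∧ (F x).1 k = true} := fun k => by
    obtain ⟨N, hN⟩ := hB k
    have hmem : ∀ x ∈ ellentuck s B, x ∈ Subtype.val '' (f ⁻¹' {y | y.1 k = true}) ↔
        (F x).1 k = true := fun x hx => by
      rw [hF x (hsub (hsubB hx))]
      simp [hsub (hsubB hx)]
    have : {x | x ∈ ellentuck s B ∧ (F x).1 k = true} = ellentuck s B ∩
        {x | ∃ x₀ ∈ ellentuck s B, (F x₀).1 k = true ∧ ∀ i < N, x₀.1 i = x.1 i} := by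
      ext x
      refine and_congr_right fun hx => ⟨fun h => ⟨x, hx, h, fun _ _ => rfl⟩, ?_⟩
      rintro ⟨x₀, hx₀, h, hag⟩
      exact (hmem x hx).1 (hN x₀ hx₀ x hx hag ((hmem x₀ hx₀).2 h))
    rw [this]
    refine (measurableSet_ellentuck s B).inter (measurableSet_of_locally_determined N ?_)
    rintro x x' hag ⟨x₀, hx₀, h, hag₀⟩
    exact ⟨x₀, hx₀, h, fun i hi => (hag₀ i hi).trans (hag i hi)⟩
  -- the restriction to `[s, B]^∞`, where `F` is continuous, makes this set Borel
  -- the restriction to `[s, B]^∞`, where `F` is continuous, makes this set Borel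
  let Q : Set InfSet := {x | x ∈ ellentuck s B ∧ Small (.node g) (tree x.labels \ ψ (F x))}
  have hQ : MeasurableSet Q := by
    have : Q = ellentuck s B ∩ {x | Small (.node g)
        (tree x.labels \ {l | x ∈ ellentuck s B ∧ l ∈ ψ (F x)})} := by
      ext x
      refine and_congr_right fun hx => ?_
      simp [hx]
    rw [this]
    refine (measurableSet_ellentuck s B).inter (measurableSet_small _ _ fun l => ?_)
    refine MeasurableSet.diff (measurableSet_mem_tree l) ?_
    have : {x | x ∈ ellentuck s B ∧ l ∈ ψ (F x)} = ⋃ (i : S) (_ : φ l = some i),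
        {x | x ∈ ellentuck s B ∧ (F x).1 (2 * Encodable.encode i) = true} := by
      ext x
      simp [hψmem]
    change MeasurableSet {x | x ∈ ellentuck s B ∧ l ∈ ψ (F x)}
    rw [this]
    exact .iUnion fun i => .iUnion fun _ => hFbit _
  obtain ⟨C, hCB, hC⟩ := hΓ' Q (Γ'.mem_of_measurableSet hQ) s B
    fun i hi j hj => hsA i hi j (hBA hj)
  have hsC : Below s C := fun i hi j hj => hsA i hi j (hBA (hCB hj))
  have hsubC := ellentuck_mono (s := s) hCB
  obtain ⟨x, hx⟩ := ellentuck_nonempty s C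
  have hxA := hsubB (hsubC hx)
  -- by thinning, `[s, C]^∞` cannot be disjoint from `Q`
  -- by thinning, `[s, C]^∞` cannot be disjoint from `Q`
  have hCQ : ellentuck s C ⊆ Q := by
    refine hC.resolve_right fun hC => ?_
    obtain ⟨z, hz, hzx⟩ := exists_tree_subset hsC hm hx (hFR x hxA).2
    have hzA := hsubB (hsubC hz)
    have heq : ψ (F x) = ψ (F z) := huniq x hxA z hzA fun h =>
      (hFR z hzA).2 ((h.union hzx).mono fun l hl => by
        by_cases hl' : l ∈ ψ (F x)
        · exact .inl ⟨hl', hl.1⟩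
        · exact .inr ⟨hl.2, hl'⟩)
    exact hC hz ⟨hsubC hz, heq ▸ hzx⟩
  obtain ⟨n₀, hn₀⟩ := hcol _ (hFR x hxA).1
  obtain ⟨z, hz, hz1, hz2⟩ := exists_tree_split hsC hm hx (hFR x hxA).2 hn₀
  have hzA := hsubB (hsubC hz)
  have hzQ := (hCQ hz).2
  have heq : ψ (F x) = ψ (F z) := huniq x hxA z hzA fun h =>
    hz1 ((h.union hzQ).mono fun l hl => by
      by_cases hl' : l ∈ ψ (F z)
      · exact .inl ⟨hl.2, hl'⟩
      · exact .inr ⟨hl.1, hl'⟩)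
  exact hz2 (heq ▸ hzQ)

/-! ### Maximal families of the ideals `Fin^α` -/

theorem IsMad.exists_inter_notMem {S : Type} {I : Set (Set S)} {𝒜 : Set (Set S)}
    (h : IsMad I 𝒜) {X : Set S} (hX : X ∉ I) : ∃ Y ∈ 𝒜, Y ∩ X ∉ I := by
  by_contra! hc
  have had : IsAlmostDisjoint I (insert X 𝒜) := by
    refine ⟨?_, ?_⟩
    · rintro Y (rfl | hY)
      · exact hX
      · exact h.1.1 Y hY
    · rintro Y (rfl | hY) Z (rfl | hZ) hne
      · exact absurd rfl hne
      · rw [Set.inter_comm]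
        exact hc Z hZ
      · exact hc Y hY
      · exact h.1.2 Y hY Z hZ hne
  have := hc X (h.2 had (Set.subset_insert X 𝒜) (Set.mem_insert X 𝒜))
  rw [Set.inter_self] at this
  exact hX this

end FinAlpha

theorem theoremt (Γ Γ' : FinAlpha.Pointclass)
    (hΓ' : ∀ P : Set FinAlpha.InfSet, Γ'.mem FinAlpha.InfSet P → FinAlpha.CompletelyRamsey P)
    (hunif : ∀ R : Set (FinAlpha.InfSet × FinAlpha.InfSet),
      Γ.mem (FinAlpha.InfSet × FinAlpha.InfSet) R → (∀ x, ∃ y, (x, y) ∈ R) →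
      ∃ (s : Finset ℕ) (A : FinAlpha.InfSet) (f : FinAlpha.ellentuck s A → FinAlpha.InfSet),
        FinAlpha.Below s A ∧ FinAlpha.Uniformises R (FinAlpha.ellentuck s A) f ∧
        Γ'.MeasurableFun (FinAlpha.ellentuck s A) f)
    (γ : Ordinal.{0} → ℕ → Ordinal.{0}) (hγ : FinAlpha.IsLadderSystem γ)
    (α : Ordinal.{0}) (hα0 : 0 < α) (hα : α < Ordinal.omega 1) :
    ¬ ∃ 𝒜 : Set (Set (FinAlpha.Idx γ α)),
      FinAlpha.IsMad (FinAlpha.finIdeal γ α) 𝒜 ∧ Γ.HasFamily 𝒜 ∧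
      FinAlpha.DedekindInfinite 𝒜 := by
  classical
  rintro ⟨𝒜, hmad, hΓ, e, he⟩
  obtain ⟨sh, hnode, hsh⟩ := FinAlpha.exists_shape hγ α hα
  obtain ⟨f, rfl⟩ := hnode hα0
  have hideal : ∀ X : Set (FinAlpha.Idx γ α),
      X ∈ FinAlpha.finIdeal γ α ↔ FinAlpha.Small (.node f) (Subtype.val '' X) := fun X => by
    rw [← hsh, Set.inter_eq_left.2]
    · exact Iff.rfl
    · rintro _ ⟨i, _, rfl⟩
      exact i.2
  obtain ⟨g, φ, h1, h2, h3⟩ := FinAlpha.exists_reindex_seq f (fun n => Subtype.val '' (e n).1)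
    fun n h => hmad.1.1 _ (e n).2 ((hideal _).2 h)
  let φ' : List ℕ → Option (FinAlpha.Idx γ α) := fun l =>
    if h : FinAlpha.IndexSet γ α (φ l) then some ⟨φ l, h⟩ else none
  have hφ' : ∀ X : Set (FinAlpha.Idx γ α),
      {l | ∃ i ∈ X, φ' l = some i} = φ ⁻¹' (Subtype.val '' X) := fun X => by
    ext l
    constructor
    · rintro ⟨i, hi, hil⟩
      by_cases h : FinAlpha.IndexSet γ α (φ l)
      · rw [show φ' l = some ⟨φ l, h⟩ from dif_pos h] at hil
        obtain rfl := Option.some_injective _ hil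
        exact ⟨_, hi, rfl⟩
      · rw [show φ' l = none from dif_neg h] at hil
        exact absurd hil (by simp)
    · rintro ⟨i, hi, hil⟩
      have h : FinAlpha.IndexSet γ α (φ l) := hil ▸ i.2
      exact ⟨i, hi, (dif_pos h).trans (congrArg some (Subtype.ext hil.symm))⟩
  refine FinAlpha.no_maximal_family Γ Γ' hΓ' hunif hΓ g φ' (fun y hy y' hy' hne => ?_)
    (fun Z hZ => ?_) fun y hy => ?_
  · rw [hφ']
    exact h1 _ ((hideal _).1 (hmad.1.2 y hy y' hy' hne))
  · have hX : (Subtype.val ⁻¹' (φ '' Z) : Set (FinAlpha.Idx γ α)) ∉ FinAlpha.finIdeal γ α := by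
      have himg : Subtype.val '' (Subtype.val ⁻¹' (φ '' Z) : Set (FinAlpha.Idx γ α)) =
          φ '' Z ∩ {s | FinAlpha.IndexSet γ α s} := by
        ext l
        exact ⟨fun ⟨i, hi, h⟩ => ⟨h ▸ hi, h ▸ i.2⟩, fun h => ⟨⟨l, h.2⟩, h.1, rfl⟩⟩
      rw [hideal, himg, ← hsh, Set.inter_assoc, Set.inter_self, hsh]
      exact fun h => hZ ((h1 _ h).mono (Set.subset_preimage_image φ Z))
    obtain ⟨y, hy, hyX⟩ := hmad.exists_inter_notMem hX
    refine ⟨y, hy, fun h => hyX ((hideal _).2 ((h2 _ h).mono ?_))⟩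
    rw [hφ']
    rintro _ ⟨i, ⟨hi, l, hl, hil⟩, rfl⟩
    exact ⟨l, ⟨⟨i, hi, hil.symm⟩, hl⟩, hil⟩
  · rw [hφ']
    by_cases hn : ∃ n₀, (e n₀).1 = y
    · obtain ⟨n₀, rfl⟩ := hn
      refine ⟨n₀, fun n hne => h3 _ n ?_⟩
      rw [← Set.image_inter Subtype.val_injective]
      exact (hideal _).1 (hmad.1.2 _ hy _ (e n).2 fun h => hne (he (Subtype.ext h)).symm)
    · refine ⟨0, fun n _ => h3 _ n ?_⟩
      rw [← Set.image_inter Subtype.val_injective]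
      exact (hideal _).1 (hmad.1.2 _ hy _ (e n).2 fun h => hn ⟨n, h.symm⟩)
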